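/- Let $d\ge 0$ be an integer, $\mathbb{D}^d=\{z\in\mathbb{C}^d : |z_j|<1 \text{ for all } j\}$ the open unit polydisk, and $f:\mathbb{D}^d\to\mathbb{C}$ analytic, with Taylor coefficients $f_\alpha=\frac{1}{\alpha!}\,\partial^\alpha f(0)$, $\alpha\in\mathbb{N}_0^d$. For a $d$-tuple $T=(T_1,\dots,T_d)$ of commuting bounded operators on a complex Hilbert space with $\|T_j\|<1$ for all $j$ (commuting strict contractions), the series $f(T):=\sum_{\alpha\in\mathbb{N}_0^d} f_\alpha\,T_1^{\alpha_1}\cdots T_d^{\alpha_d}$ converges unconditionally in operator norm. Moreover, $$\|f(T)\|\le 1$$ holds for all $d$-tuples $T$ of commuting strict contractions on all complex Hilbert spaces if and only if $\|f(M)\|\le 1$ holds for all $n\in\mathbb{N}_0$ and all $d$-tuples $M=(M_1,\dots,M_d)$ of commuting nilpotent complex $n\times n$ matrices that are strictly contractive, i.e. $\|M_j\|<1$ for all $j$ in the operator norm on $\mathbb{C}^n$ with the Euclidean norm. -/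

import Mathlib

universe u

noncomputable section

namespace Polydisk

/-- The open unit polydisk in `ℂ^d`. -/
def polydisk (d : ℕ) : Set (Fin d → ℂ) := {z | ∀ j, ‖z j‖ < 1}

/-- The partial derivative `∂f/∂z_j`. -/
def partialDeriv {d : ℕ} (j : Fin d) (f : (Fin d → ℂ) → ℂ) : (Fin d → ℂ) → ℂ :=
  fun z => fderiv ℂ f z (Pi.single j 1)

/-- The iterated partial derivative `∂_1^{α_1} ⋯ ∂_d^{α_d} f`. -/
def iteratedPartialDeriv {d : ℕ} (α : Fin d → ℕ) (f : (Fin d → ℂ) → ℂ) : (Fin d → ℂ) → ℂ :=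
  (List.finRange d).foldr (fun j g => (partialDeriv j)^[α j] g) f

/-- The Taylor coefficient `f_α = (∂^α f)(0) / α!` of `f` at the origin. -/
def taylorCoeff {d : ℕ} (f : (Fin d → ℂ) → ℂ) (α : Fin d → ℕ) : ℂ :=
  iteratedPartialDeriv α f 0 / ((∏ j, (α j).factorial : ℕ) : ℂ)

/-- The monomial `T^α = T_1^{α_1} ⋯ T_d^{α_d}`. -/
def monomialAt {d : ℕ} {A : Type*} [Monoid A] (T : Fin d → A) (α : Fin d → ℕ) : A :=
  (List.ofFn fun j => T j ^ α j).prod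

/-- The term `f_α T^α` of the power series that defines `f(T)`. -/
def seriesTerm {d : ℕ} {A : Type*} [NormedRing A] [NormedAlgebra ℂ A]
    (f : (Fin d → ℂ) → ℂ) (T : Fin d → A) (α : Fin d → ℕ) : A :=
  taylorCoeff f α • monomialAt T α

/-- `f(T) = ∑_α f_α T^α`, as a norm-convergent (unconditional) sum over all multi-indices. -/
def functionalCalculus {d : ℕ} {A : Type*} [NormedRing A] [NormedAlgebra ℂ A]
    (f : (Fin d → ℂ) → ℂ) (T : Fin d → A) : A :=
  ∑' α : Fin d → ℕ, seriesTerm f T α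

/-- `T` is a tuple of commuting strictly contractive operators on `H`. -/
structure IsCommutingStrictContraction {d : ℕ} {H : Type*} [NormedAddCommGroup H]
    [InnerProductSpace ℂ H] (T : Fin d → H →L[ℂ] H) : Prop where
  commute : ∀ i j, Commute (T i) (T j)
  norm_lt_one : ∀ j, ‖T j‖ < 1

/-- The operator on the Hilbert space `ℂ^n` given by a matrix. -/
def matrixOp {n : ℕ} (M : Matrix (Fin n) (Fin n) ℂ) :
    EuclideanSpace ℂ (Fin n) →L[ℂ] EuclideanSpace ℂ (Fin n) :=
  Matrix.toEuclideanCLM (𝕜 := ℂ) M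

end Polydisk

end

namespace Polydisk

open Filter Topology

/-! Cauchy's estimates on a polydisk of radius `r` with `max ‖T j‖ < r < 1` dominate the series by a
geometric one.

For nilpotent matrices ⇒ all operators, fix `x` and tensor each `T j` with the truncated shift on `N
+ 1` blocks. The resulting tuple `B` still consists of commuting strict contractions, and long words
in it vanish. Applied to the constant vector `(x, …, x)`, `f(B)` has as its `k`-th entry the Taylor
partial sum `s k` of `f(T) x` of degree at most `k`. The orbit of that vector spans a
finite-dimensional space on which `B` acts by nilpotent matrices, so the hypothesis gives `∑ k ≤ N,
‖s k‖² ≤ (N + 1) ‖x‖²`. Since `s k → f(T) x`, the Cesàro means of `‖s k‖²` converge to `‖f(T) x‖²`,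
whence `‖f(T) x‖ ≤ ‖x‖`. -/

/-! ### Cauchy's estimates for the Taylor coefficients -/

theorem analyticOnNhd_partialDeriv {d : ℕ} {g : (Fin d → ℂ) → ℂ}
    (hg : AnalyticOnNhd ℂ g (polydisk d)) (j : Fin d) :
    AnalyticOnNhd ℂ (partialDeriv j g) (polydisk d) := fun z hz =>
  ((ContinuousLinearMap.apply ℂ ℂ (Pi.single j (1 : ℂ) : Fin d → ℂ)).analyticAt _).comp
    (hg.fderiv z hz)

theorem analyticOnNhd_partialDeriv_iterate {d : ℕ} (j : Fin d) (k : ℕ) :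
    ∀ {g : (Fin d → ℂ) → ℂ}, AnalyticOnNhd ℂ g (polydisk d) →
      AnalyticOnNhd ℂ ((partialDeriv j)^[k] g) (polydisk d) := by
  induction k with
  | zero => exact fun hg => hg
  | succ k ih => exact fun hg => ih (analyticOnNhd_partialDeriv hg j)

theorem analyticOnNhd_foldr_partialDeriv {d : ℕ} {f : (Fin d → ℂ) → ℂ}
    (hf : AnalyticOnNhd ℂ f (polydisk d)) (α : Fin d → ℕ) (l : List (Fin d)) :
    AnalyticOnNhd ℂ (l.foldr (fun j g => (partialDeriv j)^[α j] g) f) (polydisk d) := by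
  induction l with
  | nil => exact hf
  | cons j l ih => exact analyticOnNhd_partialDeriv_iterate j (α j) ih

theorem update_mem_polydisk {d : ℕ} {z : Fin d → ℂ} (hz : z ∈ polydisk d) (j : Fin d) {w : ℂ}
    (hw : ‖w‖ < 1) : Function.update z j w ∈ polydisk d := by
  intro i
  rcases eq_or_ne i j with rfl | h
  · simpa using hw
  · simpa [h] using hz i

theorem hasDerivAt_slice {d : ℕ} {g : (Fin d → ℂ) → ℂ} (hg : AnalyticOnNhd ℂ g (polydisk d))
    {z : Fin d → ℂ} (hz : z ∈ polydisk d) (j : Fin d) {w : ℂ} (hw : ‖w‖ < 1) :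
    HasDerivAt (fun w => g (Function.update z j w))
      (partialDeriv j g (Function.update z j w)) w :=
  (hg _ (update_mem_polydisk hz j hw)).differentiableAt.hasFDerivAt.comp_hasDerivAt w
    (hasDerivAt_update z j w)

/-- Reduces to one variable, where the Cauchy estimate on a disc is available. -/
theorem partialDeriv_iterate_eq {d : ℕ} (j : Fin d) (k : ℕ) :
    ∀ {g : (Fin d → ℂ) → ℂ}, AnalyticOnNhd ℂ g (polydisk d) → ∀ {z : Fin d → ℂ},
      z ∈ polydisk d → ∀ {w : ℂ}, ‖w‖ < 1 →
      (partialDeriv j)^[k] g (Function.update z j w) =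
        iteratedDeriv k (fun w => g (Function.update z j w)) w := by
  induction k with
  | zero => intro g _ z _ w _; simp
  | succ k ih =>
    intro g hg z hz w hw
    rw [iteratedDeriv_succ', Function.iterate_succ_apply,
      ih (analyticOnNhd_partialDeriv hg j) hz hw]
    refine Filter.EventuallyEq.iteratedDeriv_eq k ?_
    filter_upwards [(isOpen_lt continuous_norm continuous_const).mem_nhds hw] with v hv
    exact (hasDerivAt_slice hg hz j hv).deriv.symm

theorem norm_partialDeriv_iterate_le {d : ℕ} {g : (Fin d → ℂ) → ℂ}
    (hg : AnalyticOnNhd ℂ g (polydisk d)) {z : Fin d → ℂ} (hz : z ∈ polydisk d) {j : Fin d}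
    (hzj : z j = 0) {r C : ℝ} (hr0 : 0 < r) (hr1 : r < 1) (k : ℕ)
    (hC : ∀ w : ℂ, ‖w‖ = r → ‖g (Function.update z j w)‖ ≤ C) :
    ‖(partialDeriv j)^[k] g z‖ ≤ k.factorial * C / r ^ k := by
  have hz0 : Function.update z j 0 = z := by rw [← hzj, Function.update_eq_self]
  have key := partialDeriv_iterate_eq j k hg hz (w := 0) (by simp)
  rw [hz0] at key
  rw [key]
  refine Complex.norm_iteratedDeriv_le_of_forall_mem_sphere_norm_le k hr0 ?_ ?_
  · refine DifferentiableOn.diffContOnCl fun w hw => ?_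
    rw [closure_ball _ hr0.ne'] at hw
    exact (hasDerivAt_slice hg hz j
      ((mem_closedBall_zero_iff.mp hw).trans_lt hr1)).differentiableAt.differentiableWithinAt
  · exact fun w hw => hC w (by simpa using hw)

/-- One-variable Cauchy estimates, one coordinate at a time. Each is centred at `z j = 0`; as `l`
has no repetitions, moving `z j` around the circle leaves the coordinates still to be treated at
`0`. -/
theorem norm_foldr_partialDeriv_le {d : ℕ} {f : (Fin d → ℂ) → ℂ}
    (hf : AnalyticOnNhd ℂ f (polydisk d)) {r C : ℝ} (hr0 : 0 < r) (hr1 : r < 1)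
    (hC : ∀ z : Fin d → ℂ, (∀ j, ‖z j‖ ≤ r) → ‖f z‖ ≤ C) (α : Fin d → ℕ) :
    ∀ l : List (Fin d), l.Nodup → ∀ z : Fin d → ℂ, (∀ j, ‖z j‖ ≤ r) → (∀ j ∈ l, z j = 0) →
      ‖l.foldr (fun j g => (partialDeriv j)^[α j] g) f z‖ ≤
        (l.map fun j => ((α j).factorial : ℝ) / r ^ α j).prod * C := by
  intro l
  induction l with
  | nil => intro _ z hz _; simpa using hC z hz
  | cons j l ih =>
    intro hl z hz hz0
    rw [List.nodup_cons] at hl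
    have := norm_partialDeriv_iterate_le (analyticOnNhd_foldr_partialDeriv hf α l)
      (z := z) (fun i => (hz i).trans_lt hr1) (hz0 j (by simp)) hr0 hr1 (α j)
      (C := (l.map fun j => ((α j).factorial : ℝ) / r ^ α j).prod * C) ?_
    · refine this.trans (le_of_eq ?_)
      rw [List.map_cons, List.prod_cons]
      ring
    · intro w hw
      refine ih hl.2 _ (fun i => ?_) fun i hi => ?_
      · rcases eq_or_ne i j with rfl | h
        · simpa using hw.le
        · simpa [h] using hz i
      · have h : i ≠ j := fun h => hl.1 (h ▸ hi)
        simpa [h] using hz0 i (by simp [hi])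

/-- Cauchy's estimates on the polydisk. -/
theorem exists_norm_taylorCoeff_le {d : ℕ} {f : (Fin d → ℂ) → ℂ}
    (hf : AnalyticOnNhd ℂ f (polydisk d)) {r : ℝ} (hr0 : 0 < r) (hr1 : r < 1) :
    ∃ C : ℝ, 0 ≤ C ∧ ∀ α, ‖taylorCoeff f α‖ ≤ C / r ^ ∑ j, α j := by
  have hsub : Metric.closedBall (0 : Fin d → ℂ) r ⊆ polydisk d := fun z hz j =>
    ((norm_le_pi_norm z j).trans (mem_closedBall_zero_iff.mp hz)).trans_lt hr1
  obtain ⟨C, hC⟩ := (isCompact_closedBall (0 : Fin d → ℂ) r).exists_bound_of_continuousOn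
    (hf.continuousOn.mono hsub)
  refine ⟨C, (norm_nonneg _).trans (hC 0 (by simp [hr0.le])), fun α => ?_⟩
  have h := norm_foldr_partialDeriv_le hf hr0 hr1 (C := C)
    (fun z hz => hC z (mem_closedBall_zero_iff.mpr ((pi_norm_le_iff_of_nonneg hr0.le).mpr hz)))
    α (List.finRange d) (List.nodup_finRange d) 0 (by simp [hr0.le]) (by simp)
  have hpos : (0 : ℝ) < ∏ j, ((α j).factorial : ℝ) :=
    Finset.prod_pos fun j _ => by exact_mod_cast (α j).factorial_pos
  rw [← List.ofFn_eq_map, List.prod_ofFn, Finset.prod_div_distrib, Finset.prod_pow_eq_pow_sum] at h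
  rw [taylorCoeff, norm_div, Complex.norm_natCast]
  push_cast
  rw [div_le_iff₀ hpos]
  refine h.trans (le_of_eq ?_)
  ring

/-! ### Convergence of the series and intertwining maps -/

theorem summable_pow_sum {q : ℝ} (h0 : 0 ≤ q) (h1 : q < 1) (d : ℕ) :
    Summable fun α : Fin d → ℕ => q ^ ∑ j, α j := by
  induction d with
  | zero => exact Summable.of_finite
  | succ d ih =>
    rw [← (Fin.consEquiv fun _ : Fin (d + 1) => ℕ).summable_iff]
    have := (summable_geometric_of_lt_one h0 h1).mul_of_nonneg ih
      (fun n => by positivity) (fun α => by positivity)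
    refine this.congr fun p => ?_
    simp [Fin.consEquiv, Fin.sum_univ_succ, pow_add]

/-- The word `0 ⋯ 0 1 ⋯ 1 ⋯` in which the letter `j` is repeated `α j` times. -/
def word {d : ℕ} (α : Fin d → ℕ) : List (Fin d) :=
  (List.ofFn fun j => List.replicate (α j) j).flatten

theorem length_word {d : ℕ} (α : Fin d → ℕ) : (word α).length = ∑ j, α j := by
  simp [word, List.length_flatten, List.map_ofFn, Function.comp_def, List.sum_ofFn]

theorem monomialAt_eq_prod_word {d : ℕ} {A : Type*} [Monoid A] (T : Fin d → A) (α : Fin d → ℕ) :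
    monomialAt T α = ((word α).map T).prod := by
  simp [monomialAt, word, List.map_flatten, List.prod_flatten, List.map_ofFn, Function.comp_def]

section Operators

variable {d : ℕ} {H K : Type*} [NormedAddCommGroup H] [InnerProductSpace ℂ H]
  [NormedAddCommGroup K] [InnerProductSpace ℂ K]

theorem norm_prod_map_le {T : Fin d → H →L[ℂ] H} {t : ℝ} (ht : ∀ j, ‖T j‖ ≤ t)
    (w : List (Fin d)) : ‖(w.map T).prod‖ ≤ t ^ w.length := by
  induction w with
  | nil =>
    rw [List.map_nil, List.prod_nil, List.length_nil, pow_zero]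
    exact ContinuousLinearMap.norm_id_le
  | cons j w ih =>
    rw [List.map_cons, List.prod_cons, List.length_cons, pow_succ']
    exact (norm_mul_le _ _).trans
      (mul_le_mul (ht j) ih (norm_nonneg _) ((norm_nonneg _).trans (ht j)))

theorem summable_seriesTerm [CompleteSpace H] {f : (Fin d → ℂ) → ℂ}
    (hf : AnalyticOnNhd ℂ f (polydisk d)) {T : Fin d → H →L[ℂ] H} (hT : ∀ j, ‖T j‖ < 1) :
    Summable (seriesTerm f T) := by
  obtain ⟨t, ht0, ht1, ht⟩ : ∃ t : ℝ, 0 ≤ t ∧ t < 1 ∧ ∀ j, ‖T j‖ ≤ t :=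
    ⟨‖T‖, norm_nonneg _, (pi_norm_lt_iff one_pos).mpr hT, norm_le_pi_norm T⟩
  obtain ⟨r, htr, hr1⟩ := exists_between ht1
  have hr0 : 0 < r := ht0.trans_lt htr
  obtain ⟨C, hC0, hC⟩ := exists_norm_taylorCoeff_le hf hr0 hr1
  refine Summable.of_norm_bounded
    ((summable_pow_sum (div_nonneg ht0 hr0.le) ((div_lt_one hr0).mpr htr) d).mul_left C)
    fun α => ?_
  rw [seriesTerm, norm_smul, monomialAt_eq_prod_word]
  refine (mul_le_mul (hC α) (norm_prod_map_le ht _) (norm_nonneg _) (by positivity)).trans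
    (le_of_eq ?_)
  rw [length_word, div_pow]
  ring

theorem prod_map_intertwine {S : Fin d → H →L[ℂ] H} {T : Fin d → K →L[ℂ] K} (V : H →L[ℂ] K)
    (hV : ∀ j x, V (S j x) = T j (V x)) (w : List (Fin d)) (x : H) :
    V ((w.map S).prod x) = (w.map T).prod (V x) := by
  induction w with
  | nil => simp
  | cons j w ih => simp [hV, ih]

theorem hasSum_functionalCalculus_apply {f : (Fin d → ℂ) → ℂ} {T : Fin d → H →L[ℂ] H}
    (hT : Summable (seriesTerm f T)) (x : H) :
    HasSum (fun α => taylorCoeff f α • ((word α).map T).prod x) (functionalCalculus f T x) := by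
  have := hT.hasSum.mapL (ContinuousLinearMap.apply ℂ H x)
  simpa [functionalCalculus, seriesTerm, monomialAt_eq_prod_word] using this

theorem functionalCalculus_intertwine {f : (Fin d → ℂ) → ℂ} {S : Fin d → H →L[ℂ] H}
    {T : Fin d → K →L[ℂ] K} (hS : Summable (seriesTerm f S)) (hT : Summable (seriesTerm f T))
    (V : H →L[ℂ] K) (hV : ∀ j x, V (S j x) = T j (V x)) (x : H) :
    V (functionalCalculus f S x) = functionalCalculus f T (V x) := by
  refine ((hasSum_functionalCalculus_apply hS x).mapL V).unique ?_
  simpa [prod_map_intertwine V hV] using hasSum_functionalCalculus_apply hT (V x)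

theorem commute_of_intertwine {S : Fin d → H →L[ℂ] H} {T : Fin d → K →L[ℂ] K} (V : H →ₗᵢ[ℂ] K)
    (hV : ∀ j x, V (S j x) = T j (V x)) (hT : ∀ i j, Commute (T i) (T j)) (i j : Fin d) :
    Commute (S i) (S j) := by
  ext x
  apply V.injective
  simpa [hV] using DFunLike.congr_fun (hT i j).eq (V x)

theorem norm_le_of_intertwine {S : H →L[ℂ] H} {T : K →L[ℂ] K} (V : H →ₗᵢ[ℂ] K)
    (hV : ∀ x, V (S x) = T (V x)) : ‖S‖ ≤ ‖T‖ := by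
  refine S.opNorm_le_bound (norm_nonneg _) fun x => ?_
  rw [← V.norm_map, hV, ← V.norm_map x]
  exact T.le_opNorm _

theorem isCommutingStrictContraction_of_intertwine {S : Fin d → H →L[ℂ] H}
    {T : Fin d → K →L[ℂ] K} (V : H →ₗᵢ[ℂ] K) (hV : ∀ j x, V (S j x) = T j (V x))
    (hT : IsCommutingStrictContraction T) : IsCommutingStrictContraction S :=
  ⟨commute_of_intertwine V hV hT.commute, fun j =>
    (norm_le_of_intertwine V (hV j)).trans_lt (hT.norm_lt_one j)⟩

end Operators

/-! ### Partial sums by total degree -/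

/-- The multi-indices of degree at most `k`. -/
def degreeLE (d k : ℕ) : Finset (Fin d → ℕ) :=
  {α ∈ Finset.Iic fun _ => k | ∑ j, α j ≤ k}

theorem mem_degreeLE {d k : ℕ} {α : Fin d → ℕ} : α ∈ degreeLE d k ↔ ∑ j, α j ≤ k := by
  rw [degreeLE, Finset.mem_filter, Finset.mem_Iic, and_iff_right_iff_imp]
  exact fun h j =>
    (Finset.single_le_sum (fun _ _ => Nat.zero_le _) (Finset.mem_univ j)).trans h

theorem tendsto_sum_degreeLE {d : ℕ} {E : Type*} [AddCommMonoid E] [TopologicalSpace E]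
    {g : (Fin d → ℕ) → E} {a : E} (hg : HasSum g a) :
    Tendsto (fun k : ℕ => ∑ α ∈ degreeLE d k, g α) atTop (𝓝 a) := by
  rw [HasSum, SummationFilter.unconditional_filter] at hg
  have h : Tendsto (degreeLE d) atTop atTop := tendsto_atTop_finset_of_monotone
    (fun k l hkl α hα => mem_degreeLE.mpr ((mem_degreeLE.mp hα).trans hkl))
    fun α => ⟨∑ j, α j, mem_degreeLE.mpr le_rfl⟩
  exact hg.comp h

theorem hasSum_ite_degree_le {d : ℕ} {E : Type*} [AddCommMonoid E] [TopologicalSpace E]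
    (g : (Fin d → ℕ) → E) (k : ℕ) :
    HasSum (fun α => if ∑ j, α j ≤ k then g α else 0) (∑ α ∈ degreeLE d k, g α) := by
  rw [Finset.sum_congr rfl fun α hα =>
    (if_pos (mem_degreeLE.mp hα) : (if ∑ j, α j ≤ k then g α else 0) = g α).symm]
  exact hasSum_sum_of_ne_finset_zero fun α hα => if_neg fun h => hα (mem_degreeLE.mpr h)

/-! ### Truncated block shifts -/

section Operators

variable {d : ℕ} {H K : Type*} [NormedAddCommGroup H] [InnerProductSpace ℂ H]
  [NormedAddCommGroup K] [InnerProductSpace ℂ K]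

/-- The truncated block shift with weight `T`: `(h_0, …, h_N) ↦ (0, T h_0, …, T h_{N-1})`. -/
noncomputable def blockShift (N : ℕ) (T : H →L[ℂ] H) :
    PiLp 2 (fun _ : Fin (N + 1) => H) →L[ℂ] PiLp 2 (fun _ : Fin (N + 1) => H) :=
  LinearMap.mkContinuous
    { toFun := fun h => WithLp.toLp 2 (Fin.cons 0 fun k : Fin N => T (h k.castSucc))
      map_add' := fun g h => by
        ext k
        cases k using Fin.cases <;> simp
      map_smul' := fun c h => by
        ext k
        cases k using Fin.cases <;> simp }
    ‖T‖ fun h => by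
      refine (sq_le_sq₀ (norm_nonneg _) (by positivity)).mp ?_
      rw [mul_pow, PiLp.norm_sq_eq_of_L2, PiLp.norm_sq_eq_of_L2, Fin.sum_univ_succ,
        Fin.sum_univ_castSucc (n := N)]
      simp only [LinearMap.coe_mk, AddHom.coe_mk, Fin.cons_zero, Fin.cons_succ, norm_zero]
      rw [mul_add, Finset.mul_sum]
      have h1 : ∑ k : Fin N, ‖T (h k.castSucc)‖ ^ 2 ≤
          ∑ k : Fin N, ‖T‖ ^ 2 * ‖h k.castSucc‖ ^ 2 := Finset.sum_le_sum fun k _ => by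
        rw [← mul_pow]
        exact pow_le_pow_left₀ (norm_nonneg _) (T.le_opNorm _) 2
      have h2 : 0 ≤ ‖T‖ ^ 2 * ‖h (Fin.last N)‖ ^ 2 := by positivity
      linarith

@[simp]
theorem blockShift_apply_zero (N : ℕ) (T : H →L[ℂ] H) (h : PiLp 2 fun _ : Fin (N + 1) => H) :
    blockShift N T h 0 = 0 := rfl

@[simp]
theorem blockShift_apply_succ (N : ℕ) (T : H →L[ℂ] H) (h : PiLp 2 fun _ : Fin (N + 1) => H)
    (k : Fin N) : blockShift N T h k.succ = T (h k.castSucc) := rfl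

theorem norm_blockShift_le (N : ℕ) (T : H →L[ℂ] H) : ‖blockShift N T‖ ≤ ‖T‖ :=
  LinearMap.mkContinuous_norm_le _ (norm_nonneg _) _

theorem commute_blockShift (N : ℕ) {S T : H →L[ℂ] H} (h : Commute S T) :
    Commute (blockShift N S) (blockShift N T) := by
  have hST : ∀ x, S (T x) = T (S x) := fun x => DFunLike.congr_fun h.eq x
  ext x k
  simp only [mul_apply_eq_comp]
  cases k using Fin.cases with
  | zero => simp
  | succ k =>
    -- Two shifts reach two blocks back, so the second block is a separate case.
    obtain ⟨N, rfl⟩ : ∃ m, N = m + 1 := ⟨N - 1, by have := k.isLt; omega⟩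
    cases k using Fin.cases with
    | zero =>
      rw [blockShift_apply_succ, blockShift_apply_succ]
      simp
    | succ k => simp [hST]

theorem isCommutingStrictContraction_blockShift (N : ℕ) {T : Fin d → H →L[ℂ] H}
    (hT : IsCommutingStrictContraction T) :
    IsCommutingStrictContraction fun j => blockShift N (T j) :=
  ⟨fun i j => commute_blockShift N (hT.commute i j), fun j =>
    (norm_blockShift_le N (T j)).trans_lt (hT.norm_lt_one j)⟩

theorem prod_blockShift_apply_of_lt (N : ℕ) (T : Fin d → H →L[ℂ] H) (w : List (Fin d)) :
    ∀ (h : PiLp 2 fun _ : Fin (N + 1) => H) (k : Fin (N + 1)), (k : ℕ) < w.length →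
      (w.map fun j => blockShift N (T j)).prod h k = 0 := by
  induction w with
  | nil => intro h k hk; simp at hk
  | cons j w ih =>
    intro h k hk
    rw [List.map_cons, List.prod_cons, mul_apply_eq_comp]
    cases k using Fin.cases with
    | zero => simp
    | succ k => rw [blockShift_apply_succ, ih _ _ (by simpa using hk), map_zero]

theorem prod_blockShift_eq_zero (N : ℕ) (T : Fin d → H →L[ℂ] H) {w : List (Fin d)}
    (hw : N < w.length) : (w.map fun j => blockShift N (T j)).prod = 0 := by
  ext h k
  simpa using prod_blockShift_apply_of_lt N T w h k (by omega)

/-- A word moves the constant vector down by its length and fills the vacated blocks with `0`. -/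
theorem prod_blockShift_const_apply (N : ℕ) (T : Fin d → H →L[ℂ] H) (x : H) (w : List (Fin d)) :
    ∀ k : Fin (N + 1), (w.map fun j => blockShift N (T j)).prod (WithLp.toLp 2 fun _ => x) k =
      if w.length ≤ k then (w.map T).prod x else 0 := by
  induction w with
  | nil => intro k; simp
  | cons j w ih =>
    intro k
    rw [List.map_cons, List.prod_cons, mul_apply_eq_comp]
    cases k using Fin.cases with
    | zero => simp
    | succ k => simp [ih, apply_ite (T j)]

theorem functionalCalculus_blockShift_const_apply (N : ℕ) (f : (Fin d → ℂ) → ℂ)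
    (T : Fin d → H →L[ℂ] H) (hs : Summable (seriesTerm f fun j => blockShift N (T j))) (x : H)
    (k : Fin (N + 1)) :
    functionalCalculus f (fun j => blockShift N (T j)) (WithLp.toLp 2 fun _ => x) k =
      ∑ α ∈ degreeLE d k, taylorCoeff f α • ((word α).map T).prod x := by
  have h1 := (hasSum_functionalCalculus_apply hs (WithLp.toLp 2 fun _ => x)).mapL
    (PiLp.proj (𝕜 := ℂ) 2 (fun _ : Fin (N + 1) => H) k)
  refine h1.unique ?_
  convert hasSum_ite_degree_le (fun α => taylorCoeff f α • ((word α).map T).prod x) (k : ℕ) with α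
  simp [prod_blockShift_const_apply, length_word]

/-! ### Reduction to nilpotent matrices -/

/-- The span of the orbit of a vector under a tuple that is annihilated by all long words is
finite-dimensional, so that the tuple restricts there to a tuple of nilpotent matrices. -/
theorem exists_nilpotent_matrices_of_prod_eq_zero {T : Fin d → K →L[ℂ] K} {m : ℕ}
    (hm : ∀ w : List (Fin d), m ≤ w.length → (w.map T).prod = 0) (v : K) :
    ∃ (n : ℕ) (M : Fin d → Matrix (Fin n) (Fin n) ℂ) (V : EuclideanSpace ℂ (Fin n) →ₗᵢ[ℂ] K),
      (∀ j y, V (matrixOp (M j) y) = T j (V y)) ∧ (∀ j, IsNilpotent (M j)) ∧ ∃ y, V y = v := by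
  set E : Submodule ℂ K := Submodule.span ℂ (Set.range fun w : List (Fin d) => (w.map T).prod v)
    with hE
  have hfin : (Set.range fun w : List (Fin d) => (w.map T).prod v).Finite := by
    refine (((List.finite_length_lt (Fin d) m).image fun w => (w.map T).prod v).union
      (Set.finite_singleton 0)).subset ?_
    rintro _ ⟨w, rfl⟩
    rcases lt_or_ge w.length m with h | h
    · exact Or.inl ⟨w, h, rfl⟩
    · exact Or.inr (by simp [hm w h])
  have : FiniteDimensional ℂ E := FiniteDimensional.span_of_finite ℂ hfin
  have hinv : ∀ j, ∀ x ∈ E, T j x ∈ E := by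
    intro j x hx
    have hle : E ≤ E.comap (T j : K →ₗ[ℂ] K) := by
      rw [hE, Submodule.span_le]
      rintro _ ⟨w, rfl⟩
      exact Submodule.subset_span ⟨j :: w, by simp⟩
    exact hle hx
  let b := stdOrthonormalBasis ℂ E
  let V : EuclideanSpace ℂ (Fin (Module.finrank ℂ E)) →ₗᵢ[ℂ] K :=
    E.subtypeₗᵢ.comp b.repr.symm.toLinearIsometry
  let R : Fin d → E →L[ℂ] E := fun j => ((T j).comp E.subtypeL).codRestrict E fun x => hinv j x x.2
  let S : Fin d → EuclideanSpace ℂ (Fin (Module.finrank ℂ E)) →L[ℂ]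
      EuclideanSpace ℂ (Fin (Module.finrank ℂ E)) := fun j =>
    (b.repr.toContinuousLinearEquiv : E →L[ℂ] _).comp
      ((R j).comp (b.repr.symm.toContinuousLinearEquiv : _ →L[ℂ] E))
  let M : Fin d → Matrix (Fin (Module.finrank ℂ E)) (Fin (Module.finrank ℂ E)) ℂ := fun j =>
    (Matrix.toEuclideanCLM (𝕜 := ℂ)).symm (S j)
  have hMS : ∀ j, matrixOp (M j) = S j := fun j => StarAlgEquiv.apply_symm_apply _ _
  have hV : ∀ j y, V (S j y) = T j (V y) := fun j y => by simp [V, S, R]; rfl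
  refine ⟨_, M, V, fun j y => by rw [hMS, hV], fun j => ⟨m, ?_⟩, ?_⟩
  · have hS : S j ^ m = 0 := by
      ext1 y
      apply V.injective
      have h := prod_map_intertwine V.toContinuousLinearMap hV (List.replicate m j) y
      have h0 := hm (List.replicate m j) (by simp)
      simp only [List.map_replicate, List.prod_replicate] at h h0
      simpa [h0] using h
    rw [← map_pow, hS, map_zero]
  · refine ⟨b.repr ⟨v, Submodule.subset_span ⟨[], by simp⟩⟩, by simp [V]⟩

end Operators

theorem norm_apply_le_of_nilpotent_matrices {d : ℕ} {f : (Fin d → ℂ) → ℂ}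
    (hf : AnalyticOnNhd ℂ f (polydisk d))
    (hM : ∀ (n : ℕ) (M : Fin d → Matrix (Fin n) (Fin n) ℂ),
      IsCommutingStrictContraction (fun j => matrixOp (M j)) → (∀ j, IsNilpotent (M j)) →
        ‖functionalCalculus f (fun j => matrixOp (M j))‖ ≤ 1)
    {K : Type*} [NormedAddCommGroup K] [InnerProductSpace ℂ K] [CompleteSpace K]
    {T : Fin d → K →L[ℂ] K} (hT : IsCommutingStrictContraction T) {m : ℕ}
    (hm : ∀ w : List (Fin d), m ≤ w.length → (w.map T).prod = 0) (v : K) :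
    ‖functionalCalculus f T v‖ ≤ ‖v‖ := by
  obtain ⟨n, M, V, hV, hnil, y, rfl⟩ := exists_nilpotent_matrices_of_prod_eq_zero hm v
  have hc : IsCommutingStrictContraction fun j => matrixOp (M j) :=
    isCommutingStrictContraction_of_intertwine V hV hT
  have h := functionalCalculus_intertwine (summable_seriesTerm hf hc.norm_lt_one)
    (summable_seriesTerm hf hT.norm_lt_one) V.toContinuousLinearMap hV y
  rw [LinearIsometry.coe_toContinuousLinearMap] at h
  rw [← h, V.norm_map, V.norm_map]
  exact ContinuousLinearMap.le_of_opNorm_le _ (hM n M hc hnil) y |>.trans_eq (one_mul _)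

/-! ### The two implications -/

theorem norm_functionalCalculus_le_of_nilpotent_matrices {d : ℕ} {f : (Fin d → ℂ) → ℂ}
    (hf : AnalyticOnNhd ℂ f (polydisk d))
    (hM : ∀ (n : ℕ) (M : Fin d → Matrix (Fin n) (Fin n) ℂ),
      IsCommutingStrictContraction (fun j => matrixOp (M j)) → (∀ j, IsNilpotent (M j)) →
        ‖functionalCalculus f (fun j => matrixOp (M j))‖ ≤ 1)
    {H : Type*} [NormedAddCommGroup H] [InnerProductSpace ℂ H] [CompleteSpace H]
    {T : Fin d → H →L[ℂ] H} (hT : IsCommutingStrictContraction T) :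
    ‖functionalCalculus f T‖ ≤ 1 := by
  refine ContinuousLinearMap.opNorm_le_bound _ zero_le_one fun x => ?_
  rw [one_mul]
  set s : ℕ → H := fun k => ∑ α ∈ degreeLE d k, taylorCoeff f α • ((word α).map T).prod x
  have hlim : Tendsto s atTop (𝓝 (functionalCalculus f T x)) :=
    tendsto_sum_degreeLE (hasSum_functionalCalculus_apply (summable_seriesTerm hf hT.norm_lt_one) x)
  -- The block shifts bound only the average of `‖s k‖²`, not each term. The index is shifted by one
  -- because there are `N + 1` blocks.
  have hces := (((hlim.norm).pow 2).cesaro).comp (tendsto_add_atTop_nat 1)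
  refine (sq_le_sq₀ (norm_nonneg _) (norm_nonneg x)).mp (le_of_tendsto' hces fun N => ?_)
  have hB := isCommutingStrictContraction_blockShift N hT
  have hle := norm_apply_le_of_nilpotent_matrices hf hM hB (m := N + 1)
    (fun w hw => prod_blockShift_eq_zero N T hw) (WithLp.toLp 2 fun _ => x)
  have hsq := pow_le_pow_left₀ (norm_nonneg _) hle 2
  simp only [PiLp.norm_sq_eq_of_L2, functionalCalculus_blockShift_const_apply N f T
    (summable_seriesTerm hf hB.norm_lt_one)] at hsq
  rw [Finset.sum_const, Finset.card_univ, Fintype.card_fin, nsmul_eq_mul] at hsq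
  rw [Function.comp_apply, ← Fin.sum_univ_eq_sum_range (fun k => ‖s k‖ ^ 2),
    inv_mul_le_iff₀ (by positivity)]
  exact hsq

/-- The hypothesis concerns spaces in `Type u`, so the matrices are transported to a `ULift`ed copy
of `ℂ^n` by a unitary. -/
theorem norm_functionalCalculus_matrixOp_le {d : ℕ} {f : (Fin d → ℂ) → ℂ}
    (hf : AnalyticOnNhd ℂ f (polydisk d))
    (hH : ∀ (H : Type u) [NormedAddCommGroup H] [InnerProductSpace ℂ H] [CompleteSpace H]
      (T : Fin d → H →L[ℂ] H), IsCommutingStrictContraction T → ‖functionalCalculus f T‖ ≤ 1)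
    {n : ℕ} {M : Fin d → Matrix (Fin n) (Fin n) ℂ}
    (hM : IsCommutingStrictContraction fun j => matrixOp (M j)) :
    ‖functionalCalculus f (fun j => matrixOp (M j))‖ ≤ 1 := by
  let V : EuclideanSpace ℂ (ULift.{u} (Fin n)) ≃ₗᵢ[ℂ] EuclideanSpace ℂ (Fin n) :=
    LinearIsometryEquiv.piLpCongrLeft 2 ℂ ℂ Equiv.ulift
  let S : Fin d → EuclideanSpace ℂ (ULift.{u} (Fin n)) →L[ℂ]
      EuclideanSpace ℂ (ULift.{u} (Fin n)) := fun j =>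
    (V.symm.toContinuousLinearEquiv : _ →L[ℂ] EuclideanSpace ℂ (ULift.{u} (Fin n))).comp
      ((matrixOp (M j)).comp (V.toContinuousLinearEquiv : _ →L[ℂ] EuclideanSpace ℂ (Fin n)))
  have hV : ∀ j y, V (S j y) = matrixOp (M j) (V y) := fun j y => by simp [S]
  have hS := isCommutingStrictContraction_of_intertwine V.toLinearIsometry hV hM
  refine ContinuousLinearMap.opNorm_le_bound _ zero_le_one fun x => ?_
  have h := functionalCalculus_intertwine (summable_seriesTerm hf hS.norm_lt_one)
    (summable_seriesTerm hf hM.norm_lt_one) V.toLinearIsometry.toContinuousLinearMap hV (V.symm x)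
  simp only [LinearIsometry.coe_toContinuousLinearMap, LinearIsometryEquiv.coe_toLinearIsometry,
    LinearIsometryEquiv.apply_symm_apply] at h
  rw [← h, V.norm_map, ← V.symm.norm_map x]
  exact ContinuousLinearMap.le_of_opNorm_le _ (hH _ S hS) _

end Polydisk

theorem theorem3 {d : ℕ} (f : (Fin d → ℂ) → ℂ)
    (hf : AnalyticOnNhd ℂ f (Polydisk.polydisk d)) :
    -- the power series of `f(T)` converges, so that `f(T)` makes sense
    (∀ (H : Type u) [NormedAddCommGroup H] [InnerProductSpace ℂ H] [CompleteSpace H]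
      (T : Fin d → H →L[ℂ] H), Polydisk.IsCommutingStrictContraction T →
        Summable (Polydisk.seriesTerm f T)) ∧
    ((∀ (H : Type u) [NormedAddCommGroup H] [InnerProductSpace ℂ H] [CompleteSpace H]
      (T : Fin d → H →L[ℂ] H), Polydisk.IsCommutingStrictContraction T →
        ‖Polydisk.functionalCalculus f T‖ ≤ 1) ↔
    (∀ (n : ℕ) (M : Fin d → Matrix (Fin n) (Fin n) ℂ),
      Polydisk.IsCommutingStrictContraction (fun j => Polydisk.matrixOp (M j)) →
      (∀ j, IsNilpotent (M j)) →
        ‖Polydisk.functionalCalculus f (fun j => Polydisk.matrixOp (M j))‖ ≤ 1)) := by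
  refine ⟨fun H _ _ _ T hT => Polydisk.summable_seriesTerm hf hT.norm_lt_one,
    fun hH n M hM _ => Polydisk.norm_functionalCalculus_matrixOp_le hf hH hM,
    fun hM H _ _ _ T hT => Polydisk.norm_functionalCalculus_le_of_nilpotent_matrices hf hM hT⟩
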